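/- Let $K\ge 2$ and let $P=(p_{i,j})\in[0,1]^{K\times K}$ be a preference matrix with $p_{i,j}+p_{j,i}=1$ for all $i,j$, where $p_{i,j}$ is the probability that arm $i$ wins a duel against arm $j$. Assume that there is a Condorcet winner $a$, that is, an arm with $p_{a,i}>\tfrac12$ for all $i\neq a$. Put $\Delta_i:=p_{a,i}-\tfrac12$ and $\Delta:=\min_{i\ne a}\Delta_i$. In each time step $t=1,2,\dots$ a learner plays a pair of arms $(I_t,J_t)$ and observes $X^{(t)}_{I_t,J_t}\in\{0,1\}$, where $X^{(t)}_{i,j}\sim\mathrm{Ber}(p_{i,j})$ and the feedback arrays $(X^{(t)}_{i,j})_{i,j}$ of different time steps $t$ are independent of each other (stationary setting). The cumulative binary weak regret up to the horizon $T\in\mathbb N$ is $$R^{\bar{\mathrm W}}(T):=\sum_{t=1}^{T}\bigl\lceil\min\{\Delta_{I_t},\Delta_{J_t}\}\bigr\rceil .$$ The algorithm Beat the Winner Reset (BtWR) with round lengths $\ell_c$ ($c\ge1$) works as follows. It draws the incumbent $I$ uniformly at random from the $K$ arms, puts the other $K-1$ arms in uniformly random order into a first-in-first-out queue (all this independently of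 the feedback), and sets $c:=1$. It then proceeds in rounds as long as there are time steps left. In each round the challenger $J$ is dequeued, and the pair $(I,J)$ is played until one of $I,J$ has won $\ell_c$ duels of this round ($I$ wins the duel in time step $t$ if $X^{(t)}_{I,J}=1$, and $J$ wins it otherwise). If $I$ has won $\ell_c$ duels, then $J$ is enqueued and $c$ is increased by $1$; otherwise $I$ is enqueued, $J$ becomes the new incumbent, and $c$ is reset to $1$. Theorem. For $$\ell_c=\left\lceil\frac{1}{4\Delta^2}\log\frac{c(c+1)e}{\delta}-\frac12\right\rceil\quad\text{with}\quad\delta=\frac1e,$$ the expected cumulative binary weak regret of BtWR satisfies, for every $T\in\mathbb N$, $$\mathbb E\bigl[R^{\bar{\mathrm W}}(T)\bigr]\le\frac{20\,K\log K}{\Delta^2}.$$ -/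

import Mathlib

open MeasureTheory ProbabilityTheory

/-! ### The stationary dueling bandits problem -/

/-- `P i j` is the probability that arm `i` wins a duel against arm `j`; there are no draws. -/
structure IsPreferenceMatrix {K : ℕ} (P : Matrix (Fin K) (Fin K) ℝ) : Prop where
  mem_Icc : ∀ i j, P i j ∈ Set.Icc (0 : ℝ) 1
  add_eq_one : ∀ i j, P i j + P j i = 1

/-- Arm `a` is the Condorcet winner: it beats every other arm with probability greater than `1/2`. -/
def IsCondorcetWinner {K : ℕ} (P : Matrix (Fin K) (Fin K) ℝ) (a : Fin K) : Prop :=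
  ∀ i, i ≠ a → 1 / 2 < P a i

/-- Suboptimality gap of arm `i` with respect to the optimal arm `a`. -/
noncomputable def gap {K : ℕ} (P : Matrix (Fin K) (Fin K) ℝ) (a i : Fin K) : ℝ :=
  P a i - 1 / 2

/-- Minimal suboptimality gap, over all arms other than the optimal arm `a`
(a minimum over a finite set, which is nonempty as soon as there are two arms). -/
noncomputable def minGap {K : ℕ} (P : Matrix (Fin K) (Fin K) ℝ) (a : Fin K) : ℝ :=
  ⨅ i : {i : Fin K // i ≠ a}, gap P a i

/-- Instantaneous weak regret of playing the pair `(i, j)`. -/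
noncomputable def weakRegret {K : ℕ} (P : Matrix (Fin K) (Fin K) ℝ) (a i j : Fin K) : ℝ :=
  min (gap P a i) (gap P a j)

/-- Instantaneous binary weak regret of playing the pair `(i, j)`. -/
noncomputable def binaryWeakRegret {K : ℕ} (P : Matrix (Fin K) (Fin K) ℝ) (a i j : Fin K) : ℤ :=
  ⌈weakRegret P a i j⌉

/-! ### The algorithm Beat the Winner Reset -/

namespace BtWR

/-- Round length `ℓ_c`; the real number below the ceiling is positive for
`c ≥ 1`, `0 < Δ ≤ 1/2` and `0 < δ < 1`. -/
noncomputable def roundLength (Δ δ : ℝ) (c : ℕ) : ℕ :=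
  ⌈1 / (4 * Δ ^ 2) * Real.log ((c : ℝ) * ((c : ℝ) + 1) * Real.exp 1 / δ) - 1 / 2⌉₊

/-- Memory of the algorithm just before a duel: the incumbent `a_I`, the challenger `a_J` (already
dequeued), the FIFO queue `Q` (first element = next to be dequeued), the round counter `c`, and the
numbers of wins `w_I`, `w_J` in the current round. -/
structure State (K : ℕ) where
  incumbent : Fin K
  challenger : Fin K
  queue : List (Fin K)
  c : ℕ
  wI : ℕ
  wJ : ℕ

/-- Start a round with incumbent `i`, queue `q` and round counter `c`: dequeue the challenger and
set the numbers of wins to zero. The queue is never empty here if there are at least two arms. -/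
def startRound {K : ℕ} (i : Fin K) (q : List (Fin K)) (c : ℕ) : State K :=
  match q with
  | [] => ⟨i, i, [], c, 0, 0⟩
  | j :: q' => ⟨i, j, q', c, 0, 0⟩

/-- One time step with round lengths `ℓ`: play the pair `(a_I, a_J)` and observe
`x a_I a_J` (`true` if `a_I` wins), update the numbers of wins and, if the round is over, enqueue
its loser, update the incumbent and the round counter, and start the next round. -/
def step {K : ℕ} (ℓ : ℕ → ℕ) (x : Fin K → Fin K → Bool) (s : State K) : State K :=
  let b := x s.incumbent s.challenger
  let wI := s.wI + if b = true then 1 else 0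
  let wJ := s.wJ + if b = false then 1 else 0
  if wI < ℓ s.c ∧ wJ < ℓ s.c then
    { s with wI := wI, wJ := wJ }
  else if wI = ℓ s.c then
    startRound s.incumbent (s.queue ++ [s.challenger]) (s.c + 1)
  else
    startRound s.challenger (s.queue ++ [s.incumbent]) 1

/-- The state before time step `t` (time steps are numbered `0, 1, 2, …`), if the initial incumbent
is `i`, the initial queue is `q 0, q 1, …, q (K - 2)`, and the outcome of a duel of `i'` against
`j'` in time step `t'` is `x t' i' j'`. -/
def run {K : ℕ} (ℓ : ℕ → ℕ) (i : Fin K) (q : Fin (K - 1) → Fin K)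
    (x : ℕ → Fin K → Fin K → Bool) : ℕ → State K
  | 0 => startRound i (List.ofFn q) 1
  | t + 1 => step ℓ (x t) (run ℓ i q x t)

/-- Cumulative binary weak regret of the algorithm over the first `T` time steps, for the preference
matrix `P` with Condorcet winner `a`. -/
noncomputable def cumBinaryWeakRegret {K : ℕ} (P : Matrix (Fin K) (Fin K) ℝ) (a : Fin K)
    (ℓ : ℕ → ℕ) (i : Fin K) (q : Fin (K - 1) → Fin K) (x : ℕ → Fin K → Fin K → Bool)
    (T : ℕ) : ℤ :=
  ∑ t ∈ Finset.range T,
    binaryWeakRegret P a (run ℓ i q x t).incumbent (run ℓ i q x t).challenger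

end BtWR

/-! ### The randomness -/

/-- `X t i j` is the outcome of a duel of arm `i` against arm `j` in time step `t` (`true` if `i`
wins): Bernoulli with parameter `P i j`, and independent over the time steps. Within one time step,
in which a single pair is played, no independence is required (so that `X t j i` may or may not be
the negation of `X t i j`). -/
structure IsDuelFeedback {K : ℕ} (P : Matrix (Fin K) (Fin K) ℝ) {Ω : Type*} [MeasurableSpace Ω]
    (μ : Measure Ω) (X : ℕ → Fin K → Fin K → Ω → Bool) : Prop where
  measurable : ∀ t i j, Measurable (X t i j)
  bernoulli : ∀ t i j, μ {ω | X t i j ω = true} = ENNReal.ofReal (P i j)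
  indep : iIndepFun (fun t ω i j => X t i j ω) μ

/-- The initial incumbent `I` is uniformly distributed over the `K` arms and, given `I`, the initial
queue `Q` is uniformly distributed over the `(K - 1)!` orderings of the other arms. -/
structure IsUniformStart {K : ℕ} {Ω : Type*} [MeasurableSpace Ω]
    (μ : Measure Ω) (I : Ω → Fin K) (Q : Ω → Fin (K - 1) → Fin K) : Prop where
  measurable_incumbent : Measurable I
  measurable_queue : Measurable Q
  uniform : ∀ (i : Fin K) (q : Fin (K - 1) → Fin K), Function.Injective q → (∀ k, q k ≠ i) →
    μ {ω | I ω = i ∧ Q ω = q} = (K : ENNReal)⁻¹ * ((K - 1).factorial : ENNReal)⁻¹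

/-! A duel costs 1 exactly when the best arm `a` is not in it. `potential` bounds the expected
number of such duels still to come: on average it falls by at least the cost of each duel
(`potential_drift`). Telescoping (`sum_integral_regret_le`) then bounds the regret by the initial
potential, uniformly in `T`.

The potential depends on the role of `a`. Waiting at position `k` of the queue, `a` becomes
challenger after the current round and `k` more; a round has at most `2 * ℓ c - 1` duels and the
counter grows by at most one per round, so the cost until then is bounded deterministically by
`passBound`. Once in the duel, `a` loses a round with counter `c` with probability at most `d / (c
(c + 1))`, by the exponential supermartingale `raceBound`; summed over a whole reign as incumbent
this gives at most `d`. A loss puts `a` behind the `K - 2` other queued arms.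

So the bound `D` for the regret from the moment `a` becomes challenger must satisfy a
self-consistency inequality (`le_D`): its left side contains `D` again, but for `d = 1 / e` with
total coefficient at most `3 / (2e) < 1`. Hence some `D` of order `K log K / Δ ^ 2` works
(`driftData_roundLength`). All this holds for every start that lists each arm once, and the random
start is almost surely of this kind (`IsUniformStart.ae_injective`). -/

/-! ### Losing a race between two arms -/

/-- After multiplication by `exp (y ^ 2 / 2)` the left side equals 1 at 0 and has derivative `-y ^ 2
* sinh y * exp (y ^ 2 / 2) ≤ 0`. -/
lemma cosh_sub_mul_sinh_le_exp {x : ℝ} (hx : 0 ≤ x) :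
    Real.cosh x - x * Real.sinh x ≤ Real.exp (-(x ^ 2 / 2)) := by
  have hder : ∀ y : ℝ, HasDerivAt
      (fun y => Real.exp (y ^ 2 / 2) * (Real.cosh y - y * Real.sinh y))
      (-(y ^ 2 * Real.sinh y * Real.exp (y ^ 2 / 2))) y := by
    intro y
    have h1 : HasDerivAt (fun y : ℝ => Real.exp (y ^ 2 / 2)) (Real.exp (y ^ 2 / 2) * y) y := by
      refine ((hasDerivAt_pow 2 y).div_const 2).exp.congr_deriv ?_
      push_cast
      ring
    have h2 := (Real.hasDerivAt_cosh y).sub ((hasDerivAt_id y).mul (Real.hasDerivAt_sinh y))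
    refine (h1.mul h2).congr_deriv ?_
    simp only [id, Pi.sub_apply, Pi.mul_apply]
    ring
  have hanti : AntitoneOn (fun y => Real.exp (y ^ 2 / 2) * (Real.cosh y - y * Real.sinh y))
      (Set.Ici 0) := by
    refine antitoneOn_of_deriv_nonpos (convex_Ici 0)
      (fun y _ => (hder y).continuousAt.continuousWithinAt)
      (fun y _ => (hder y).differentiableAt.differentiableWithinAt) fun y hy => ?_
    rw [interior_Ici, Set.mem_Ioi] at hy
    rw [(hder y).deriv, Left.neg_nonpos_iff]
    have := Real.sinh_nonneg_iff.2 hy.le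
    positivity
  have h := hanti (Set.mem_Ici.2 le_rfl) (Set.mem_Ici.2 hx) hx
  simp only [Real.cosh_zero, Real.sinh_zero] at h
  rw [Real.exp_neg, ← one_div, le_div_iff₀ (Real.exp_pos _), mul_comm]
  simpa using h

/-- Bound for the probability that an arm that wins each duel with probability at least
`1 / 2 + Δ` loses a race to `n` wins, in which it has `u` wins and its opponent `v` wins. -/
noncomputable def raceBound (Δ : ℝ) (n u v : ℕ) : ℝ :=
  Real.exp (2 * Δ * ((v : ℝ) - u) - 2 * Δ ^ 2 * (2 * n - 1 - u - v))

lemma raceBound_nonneg (Δ : ℝ) (n u v : ℕ) : 0 ≤ raceBound Δ n u v := (Real.exp_pos _).le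

/-- Terminal condition of the supermartingale: once the race is lost, the bound dominates the
indicator of that event. -/
lemma one_le_raceBound {Δ : ℝ} (h0 : 0 ≤ Δ) (h1 : Δ ≤ 1 / 2) {n u v : ℕ} (hu : u < n)
    (hv : n ≤ v) : 1 ≤ raceBound Δ n u v := by
  refine Real.one_le_exp ?_
  have hu' : (u : ℝ) + 1 ≤ n := by exact_mod_cast hu
  have hv' : (n : ℝ) ≤ v := by exact_mod_cast hv
  have e : 2 * Δ * ((v : ℝ) - u) - 2 * Δ ^ 2 * (2 * n - 1 - u - v)
      = 2 * Δ * ((1 - Δ) * (n - 1 - u) + 1 + (1 + Δ) * (v - n)) := by ring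
  rw [e]
  have := mul_nonneg (by linarith : 0 ≤ 1 - Δ) (by linarith : 0 ≤ (n : ℝ) - 1 - u)
  have := mul_nonneg (by linarith : 0 ≤ 1 + Δ) (by linarith : 0 ≤ (v : ℝ) - n)
  have : 0 ≤ (1 - Δ) * ((n : ℝ) - 1 - u) + 1 + (1 + Δ) * (v - n) := by linarith
  positivity

/-- Supermartingale property. With `x = 2Δ`, a duel multiplies the bound on average by `exp (x ^ 2 /
2) * (cosh x - (2p - 1) sinh x)`; since `2p - 1 ≥ x`, `cosh_sub_mul_sinh_le_exp` makes this at most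
1. -/
lemma raceBound_average_le {Δ p : ℝ} (h0 : 0 ≤ Δ) (hp : 1 / 2 + Δ ≤ p) (n u v : ℕ) :
    p * raceBound Δ n (u + 1) v + (1 - p) * raceBound Δ n u (v + 1) ≤ raceBound Δ n u v := by
  have e1 : raceBound Δ n (u + 1) v
      = raceBound Δ n u v * Real.exp (2 * Δ ^ 2) * Real.exp (-(2 * Δ)) := by
    unfold raceBound
    rw [← Real.exp_add, ← Real.exp_add]
    push_cast
    ring_nf
  have e2 : raceBound Δ n u (v + 1)
      = raceBound Δ n u v * Real.exp (2 * Δ ^ 2) * Real.exp (2 * Δ) := by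
    unfold raceBound
    rw [← Real.exp_add, ← Real.exp_add]
    push_cast
    ring_nf
  have h := cosh_sub_mul_sinh_le_exp (x := 2 * Δ) (by positivity)
  rw [Real.cosh_eq, Real.sinh_eq] at h
  have hexp : Real.exp (-(2 * Δ)) ≤ Real.exp (2 * Δ) := Real.exp_le_exp.2 (by linarith)
  have key : p * Real.exp (-(2 * Δ)) + (1 - p) * Real.exp (2 * Δ)
      ≤ Real.exp (-((2 * Δ) ^ 2 / 2)) := by
    nlinarith [mul_nonneg (sub_nonneg.2 hp) (sub_nonneg.2 hexp)]
  have hone : Real.exp (2 * Δ ^ 2) * Real.exp (-((2 * Δ) ^ 2 / 2)) = 1 := by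
    rw [← Real.exp_add]
    ring_nf
    exact Real.exp_zero
  calc p * raceBound Δ n (u + 1) v + (1 - p) * raceBound Δ n u (v + 1)
      = raceBound Δ n u v * Real.exp (2 * Δ ^ 2)
        * (p * Real.exp (-(2 * Δ)) + (1 - p) * Real.exp (2 * Δ)) := by rw [e1, e2]; ring
    _ ≤ raceBound Δ n u v * Real.exp (2 * Δ ^ 2) * Real.exp (-((2 * Δ) ^ 2 / 2)) :=
        mul_le_mul_of_nonneg_left key
          (mul_nonneg (raceBound_nonneg _ _ _ _) (Real.exp_pos _).le)
    _ = raceBound Δ n u v := by rw [mul_assoc, hone, mul_one]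

namespace BtWR

/-! ### The potential of a state -/

/-- Bound for the expected regret from the start of a round with counter `c`, if the best arm becomes
challenger after `k` further rounds: a round with counter `c` costs at most `m c`, and `D` bounds
the regret from the time at which the best arm is the challenger. -/
def passBound (m : ℕ → ℝ) (D : ℝ) : ℕ → ℕ → ℝ
  | 0, _ => D
  | k + 1, c => m c + passBound m D k (c + 1)

lemma passBound_nonneg {m : ℕ → ℝ} {D : ℝ} (hm : ∀ c, 0 ≤ m c) (hD : 0 ≤ D) (k c : ℕ) :
    0 ≤ passBound m D k c := by
  induction k generalizing c with
  | zero => exact hD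
  | succ k ih => exact add_nonneg (hm c) (ih _)

lemma passBound_mono {m : ℕ → ℝ} {D : ℝ} (hm : Monotone m) (k : ℕ) :
    Monotone (passBound m D k) := by
  induction k with
  | zero => exact fun _ _ _ => le_rfl
  | succ k ih => exact fun c c' h => add_le_add (hm h) (ih (Nat.succ_le_succ h))

lemma passBound_mono_left {m : ℕ → ℝ} {D : ℝ} (hm : Monotone m) (hm0 : ∀ c, 0 ≤ m c) (c : ℕ) :
    Monotone fun k => passBound m D k c := by
  refine monotone_nat_of_le_succ fun k => ?_
  have := passBound_mono (D := D) hm k (Nat.le_succ c)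
  have := hm0 c
  change _ ≤ m c + passBound m D k (c + 1)
  linarith

/-- The rounds passed have counters `c + 1, …, c + k`, and the last one has the largest `m`. -/
lemma passBound_succ_le {m : ℕ → ℝ} {D : ℝ} (hm : Monotone m) (k c : ℕ) :
    passBound m D k (c + 1) ≤ k * m (c + k) + D := by
  induction k generalizing c with
  | zero => simp [passBound]
  | succ k ih =>
    have h1 : m (c + 1) ≤ m (c + (k + 1)) := hm (by omega)
    have h2 := ih (c + 1)
    rw [show c + 1 + k = c + (k + 1) by ring] at h2
    change m (c + 1) + passBound m D k (c + 1 + 1) ≤ _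
    push_cast
    linarith

/-- The data of the potential argument: round lengths `ℓ`, bounds `m` for the duration of a round,
a bound `D` for the regret from the time at which the best arm is the challenger, and `d` such that
the best arm loses a round with counter `c` with probability at most `d / (c (c + 1))`. -/
structure DriftData (K : ℕ) (Δ d D : ℝ) (ℓ : ℕ → ℕ) (m : ℕ → ℝ) : Prop where
  gap_nonneg : 0 ≤ Δ
  gap_le : Δ ≤ 1 / 2
  d_nonneg : 0 ≤ d
  D_nonneg : 0 ≤ D
  m_nonneg : ∀ c, 0 ≤ m c
  m_mono : Monotone m
  length_pos : ∀ c, 1 ≤ c → 0 < ℓ c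
  length_le : ∀ c, 1 ≤ c → 2 * (ℓ c : ℝ) - 1 ≤ m c
  race_le : ∀ c, 1 ≤ c → raceBound Δ (ℓ c) 0 0 ≤ d / (c * (c + 1))
  le_D : ∀ c : ℕ, 1 ≤ c →
    d / (c * (c + 1)) * passBound m D (K - 2) (c + 1) + d * passBound m D (K - 2) 1 ≤ D

/-- Bound for the expected future regret, by the role of the best arm `a`. -/
noncomputable def potential {K : ℕ} (a : Fin K) (Δ d D : ℝ) (ℓ : ℕ → ℕ) (m : ℕ → ℝ)
    (s : State K) : ℝ :=
  if s.incumbent = a then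
    (raceBound Δ (ℓ s.c) s.wI s.wJ + d / (s.c + 1)) * passBound m D (K - 2) 1
  else if s.challenger = a then
    raceBound Δ (ℓ s.c) s.wJ s.wI * passBound m D (K - 2) (s.c + 1)
      + d * passBound m D (K - 2) 1
  else
    2 * (ℓ s.c : ℝ) - 1 - s.wI - s.wJ + passBound m D (s.queue.idxOf a) (s.c + 1)

/-- The binary weak regret of the next duel, if the best arm is `a`. -/
noncomputable def stateRegret {K : ℕ} (a : Fin K) (s : State K) : ℝ :=
  if s.incumbent = a ∨ s.challenger = a then 0 else 1

/-- The invariant of the states of the algorithm. -/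
structure State.Valid {K : ℕ} (ℓ : ℕ → ℕ) (s : State K) : Prop where
  nodup : (s.incumbent :: s.challenger :: s.queue).Nodup
  length : s.queue.length + 2 = K
  one_le_c : 1 ≤ s.c
  wI_lt : s.wI < ℓ s.c
  wJ_lt : s.wJ < ℓ s.c

lemma State.Valid.mem {K : ℕ} {ℓ : ℕ → ℕ} {s : State K} (hs : s.Valid ℓ) (a : Fin K) :
    a = s.incumbent ∨ a = s.challenger ∨ a ∈ s.queue := by
  have hcard : (s.incumbent :: s.challenger :: s.queue).toFinset = Finset.univ := by
    rw [← Finset.card_eq_iff_eq_univ, List.toFinset_card_of_nodup hs.nodup, Fintype.card_fin]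
    simpa using hs.length
  have := Finset.mem_univ a
  rw [← hcard] at this
  simpa using this

lemma valid_startRound {K : ℕ} {ℓ : ℕ → ℕ} (hℓ : ∀ c, 1 ≤ c → 0 < ℓ c) {i : Fin K}
    {q : List (Fin K)} {c : ℕ} (hK : 2 ≤ K) (hnd : (i :: q).Nodup) (hq : q.length + 1 = K)
    (hc : 1 ≤ c) : (startRound i q c).Valid ℓ := by
  cases q with
  | nil => simp at hq; omega
  | cons j q => exact ⟨hnd, by simpa [startRound] using hq, hc, hℓ c hc, hℓ c hc⟩

/-- The state after a duel won by the incumbent (`b = true`) or by the challenger. -/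
def advance {K : ℕ} (ℓ : ℕ → ℕ) (b : Bool) (s : State K) : State K :=
  step ℓ (fun _ _ => b) s

/-- Only the entry of the pair played is read, so the joint law of the feedback within one time step
is irrelevant. -/
lemma step_eq_advance {K : ℕ} (ℓ : ℕ → ℕ) (x : Fin K → Fin K → Bool) (s : State K) :
    step ℓ x s = advance ℓ (x s.incumbent s.challenger) s := rfl

lemma advance_true {K : ℕ} {ℓ : ℕ → ℕ} {s : State K} (hs : s.Valid ℓ) :
    advance ℓ true s = if s.wI + 1 < ℓ s.c then { s with wI := s.wI + 1 }
      else startRound s.incumbent (s.queue ++ [s.challenger]) (s.c + 1) := by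
  have h1 := hs.wI_lt
  have h2 := hs.wJ_lt
  by_cases h : s.wI + 1 < ℓ s.c
  · simp [advance, step, h, h2]
  · have h' : s.wI + 1 = ℓ s.c := by omega
    simp [advance, step, h']

lemma advance_false {K : ℕ} {ℓ : ℕ → ℕ} {s : State K} (hs : s.Valid ℓ) :
    advance ℓ false s = if s.wJ + 1 < ℓ s.c then { s with wJ := s.wJ + 1 }
      else startRound s.challenger (s.queue ++ [s.incumbent]) 1 := by
  have h1 := hs.wI_lt
  have h2 := hs.wJ_lt
  by_cases h : s.wJ + 1 < ℓ s.c
  · simp [advance, step, h, h1]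
  · simp [advance, step, h, h1.ne]

lemma State.Valid.advance {K : ℕ} {ℓ : ℕ → ℕ} (hℓ : ∀ c, 1 ≤ c → 0 < ℓ c) {s : State K}
    (hs : s.Valid ℓ) (b : Bool) : (BtWR.advance ℓ b s).Valid ℓ := by
  have hK : 2 ≤ K := by have := hs.length; omega
  cases b
  · rw [advance_false hs]
    split_ifs with h
    · exact ⟨hs.nodup, hs.length, hs.one_le_c, hs.wI_lt, h⟩
    · refine valid_startRound hℓ hK ?_ (by simpa using hs.length) le_rfl
      have hp : (s.challenger :: (s.queue ++ [s.incumbent])).Perm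
          (s.incumbent :: s.challenger :: s.queue) :=
        (List.perm_append_singleton s.incumbent (s.challenger :: s.queue))
      exact hp.nodup_iff.2 hs.nodup
  · rw [advance_true hs]
    split_ifs with h
    · exact ⟨hs.nodup, hs.length, hs.one_le_c, h, hs.wJ_lt⟩
    · refine valid_startRound hℓ hK ?_ (by simpa using hs.length) (by omega)
      exact ((List.perm_append_singleton s.challenger s.queue).cons _).nodup_iff.2 hs.nodup

/-! ### Drift of the potential -/

section Drift

variable {K : ℕ} {a : Fin K} {Δ d D : ℝ} {ℓ : ℕ → ℕ} {m : ℕ → ℝ}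

lemma DriftData.passBound_nonneg (h : DriftData K Δ d D ℓ m) (k c : ℕ) :
    0 ≤ passBound m D k c :=
  BtWR.passBound_nonneg h.m_nonneg h.D_nonneg k c

lemma potential_nonneg (h : DriftData K Δ d D ℓ m) {s : State K} (hs : s.Valid ℓ) :
    0 ≤ potential a Δ d D ℓ m s := by
  have hd := h.d_nonneg
  have hW := h.passBound_nonneg
  unfold potential
  split_ifs
  · have := raceBound_nonneg Δ (ℓ s.c) s.wI s.wJ
    exact mul_nonneg (by positivity) (hW _ _)
  · exact add_nonneg (mul_nonneg (raceBound_nonneg _ _ _ _) (hW _ _)) (mul_nonneg hd (hW _ _))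
  · have h1 : (s.wI : ℝ) + 1 ≤ ℓ s.c := by exact_mod_cast hs.wI_lt
    have h2 : (s.wJ : ℝ) + 1 ≤ ℓ s.c := by exact_mod_cast hs.wJ_lt
    have := hW (s.queue.idxOf a) (s.c + 1)
    linarith

/-- Telescoping: `d / (c (c + 1)) + d / (c + 1) = d / c`, so `d / c` bounds the probability that an
incumbent `a` with counter `c` is ever dethroned. -/
lemma potential_startRound_self_le (h : DriftData K Δ d D ℓ m) (q : List (Fin K)) {c : ℕ}
    (hc : 1 ≤ c) :
    potential a Δ d D ℓ m (startRound a q c) ≤ d / c * passBound m D (K - 2) 1 := by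
  have hc' : (0 : ℝ) < c := by exact_mod_cast hc
  have hr := h.race_le c hc
  have e : d / (c * (c + 1)) + d / (c + 1) = d / c := by field_simp; ring
  have hW := h.passBound_nonneg (K - 2) 1
  have : potential a Δ d D ℓ m (startRound a q c)
      = (raceBound Δ (ℓ c) 0 0 + d / (c + 1)) * passBound m D (K - 2) 1 := by
    cases q <;> simp [startRound, potential]
  rw [this, ← e]
  gcongr

/-- If `a` is dequeued, this is the self-consistency inequality `le_D`; otherwise `length_le` pays
for one unfolding of `passBound`. -/
lemma potential_startRound_le (h : DriftData K Δ d D ℓ m) {i : Fin K} (hi : i ≠ a)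
    {q : List (Fin K)} (hq : q ≠ []) {c : ℕ} (hc : 1 ≤ c) :
    potential a Δ d D ℓ m (startRound i q c) ≤ passBound m D (q.idxOf a) c := by
  cases q with
  | nil => exact absurd rfl hq
  | cons j q =>
    by_cases hj : j = a
    · subst hj
      have hr := h.race_le c hc
      have hW := h.passBound_nonneg (K - 2) (c + 1)
      have hD := h.le_D c hc
      simp only [startRound, potential, hi, if_true, if_false, List.idxOf_cons_self, passBound]
      nlinarith [mul_le_mul_of_nonneg_right hr hW]
    · have hl := h.length_le c hc
      simp only [startRound, potential, hi, hj, if_false, List.idxOf_cons_ne _ hj, passBound]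
      push_cast
      linarith

/-- The potential decreases on average by at least the regret of a duel. -/
lemma potential_drift (h : DriftData K Δ d D ℓ m) {P : Matrix (Fin K) (Fin K) ℝ}
    (hP : IsPreferenceMatrix P) (hgap : ∀ i, i ≠ a → 1 / 2 + Δ ≤ P a i) {s : State K}
    (hs : s.Valid ℓ) :
    stateRegret a s
      + (P s.incumbent s.challenger * potential a Δ d D ℓ m (advance ℓ true s)
        + (1 - P s.incumbent s.challenger) * potential a Δ d D ℓ m (advance ℓ false s))
      ≤ potential a Δ d D ℓ m s := by
  have hp := hP.mem_Icc s.incumbent s.challenger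
  have hp0 := hp.1
  have hp1 : 0 ≤ 1 - P s.incumbent s.challenger := sub_nonneg.2 hp.2
  have hnd := hs.nodup
  have hmem := hs.mem a
  have hlen : s.queue.length = K - 2 := by have := hs.length; omega
  have hW := h.passBound_nonneg
  have hc : (0 : ℝ) < s.c := by exact_mod_cast hs.one_le_c
  simp only [List.nodup_cons, List.mem_cons, not_or] at hnd
  obtain ⟨⟨hIJ, hIq⟩, hJq, -⟩ := hnd
  by_cases hI : s.incumbent = a
  · have hJ : s.challenger ≠ a := fun hJ => hIJ (hI.trans hJ.symm)
    have haq : a ∉ s.queue := hI ▸ hIq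
    have hT : potential a Δ d D ℓ m (advance ℓ true s)
        ≤ (raceBound Δ (ℓ s.c) (s.wI + 1) s.wJ + d / (s.c + 1)) * passBound m D (K - 2) 1 := by
      rw [advance_true hs]
      split_ifs with hw
      · simp [potential, hI]
      · rw [hI]
        refine (potential_startRound_self_le h _ (by omega)).trans ?_
        push_cast
        exact mul_le_mul_of_nonneg_right (le_add_of_nonneg_left (raceBound_nonneg _ _ _ _)) (hW _ _)
    have hF : potential a Δ d D ℓ m (advance ℓ false s)
        ≤ (raceBound Δ (ℓ s.c) s.wI (s.wJ + 1) + d / (s.c + 1)) * passBound m D (K - 2) 1 := by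
      rw [advance_false hs]
      split_ifs with hw
      · simp [potential, hI]
      · refine (potential_startRound_le h hJ (by simp) le_rfl).trans ?_
        -- The dethroned `a` is enqueued last, at index `K - 2`; the factor `raceBound ≥ 1` pays for
        -- the way back.
        rw [hI, List.idxOf_append_of_notMem haq, List.idxOf_cons_self, add_zero, hlen]
        have h1 := one_le_raceBound h.gap_nonneg h.gap_le hs.wI_lt (not_lt.1 hw)
        have h2 : 0 ≤ d / ((s.c : ℝ) + 1) := div_nonneg h.d_nonneg (by positivity)
        exact le_mul_of_one_le_left (hW _ _) (by linarith)
    have hav := raceBound_average_le h.gap_nonneg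
      (show 1 / 2 + Δ ≤ P s.incumbent s.challenger from hI ▸ hgap _ hJ) (ℓ s.c) s.wI s.wJ
    have e : potential a Δ d D ℓ m s
        = (raceBound Δ (ℓ s.c) s.wI s.wJ + d / (s.c + 1)) * passBound m D (K - 2) 1 := by
      simp [potential, hI]
    rw [e, stateRegret, if_pos (Or.inl hI), zero_add]
    nlinarith [mul_le_mul_of_nonneg_left hT hp0, mul_le_mul_of_nonneg_left hF hp1,
      mul_le_mul_of_nonneg_right hav (hW (K - 2) 1)]
  by_cases hJ : s.challenger = a
  · have haq : a ∉ s.queue := hJ ▸ hJq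
    have hT : potential a Δ d D ℓ m (advance ℓ true s)
        ≤ raceBound Δ (ℓ s.c) s.wJ (s.wI + 1) * passBound m D (K - 2) (s.c + 1)
          + d * passBound m D (K - 2) 1 := by
      rw [advance_true hs]
      split_ifs with hw
      · simp [potential, hI, hJ]
      · refine (potential_startRound_le h hI (by simp) (by omega)).trans ?_
        rw [hJ, List.idxOf_append_of_notMem haq, List.idxOf_cons_self, add_zero, hlen]
        have h1 := one_le_raceBound h.gap_nonneg h.gap_le hs.wJ_lt (not_lt.1 hw)
        have h2 := mul_nonneg h.d_nonneg (hW (K - 2) 1)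
        have h3 := le_mul_of_one_le_left (hW (K - 2) (s.c + 1)) h1
        linarith
    have hF : potential a Δ d D ℓ m (advance ℓ false s)
        ≤ raceBound Δ (ℓ s.c) (s.wJ + 1) s.wI * passBound m D (K - 2) (s.c + 1)
          + d * passBound m D (K - 2) 1 := by
      rw [advance_false hs]
      split_ifs with hw
      · simp [potential, hI, hJ]
      · rw [hJ]
        refine (potential_startRound_self_le h _ le_rfl).trans ?_
        rw [Nat.cast_one, div_one]
        exact le_add_of_nonneg_left (mul_nonneg (raceBound_nonneg _ _ _ _) (hW _ _))
    have hsum := hP.add_eq_one s.incumbent s.challenger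
    have hav := raceBound_average_le h.gap_nonneg
      (show 1 / 2 + Δ ≤ 1 - P s.incumbent s.challenger by
        have := hgap _ hI
        rw [← hJ] at this
        linarith) (ℓ s.c) s.wJ s.wI
    have e : potential a Δ d D ℓ m s
        = raceBound Δ (ℓ s.c) s.wJ s.wI * passBound m D (K - 2) (s.c + 1)
          + d * passBound m D (K - 2) 1 := by
      simp [potential, hI, hJ]
    rw [e, stateRegret, if_pos (Or.inr hJ), zero_add]
    nlinarith [mul_le_mul_of_nonneg_left hT hp0, mul_le_mul_of_nonneg_left hF hp1,
      mul_le_mul_of_nonneg_right hav (hW (K - 2) (s.c + 1))]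
  · have haq : a ∈ s.queue := by
      rcases hmem with h | h | h
      · exact absurd h.symm hI
      · exact absurd h.symm hJ
      · exact h
    have e : potential a Δ d D ℓ m s
        = 2 * (ℓ s.c : ℝ) - 1 - s.wI - s.wJ + passBound m D (s.queue.idxOf a) (s.c + 1) := by
      simp [potential, hI, hJ]
    have h1 : (s.wI : ℝ) + 1 ≤ ℓ s.c := by exact_mod_cast hs.wI_lt
    have h2 : (s.wJ : ℝ) + 1 ≤ ℓ s.c := by exact_mod_cast hs.wJ_lt
    have hT : potential a Δ d D ℓ m (advance ℓ true s) ≤ potential a Δ d D ℓ m s - 1 := by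
      rw [advance_true hs, e]
      split_ifs with hw
      · simp only [potential, hI, hJ, if_false]
        push_cast
        linarith
      · refine (potential_startRound_le h hI (by simp) (by omega)).trans ?_
        rw [List.idxOf_append_of_mem haq]
        linarith
    have hF : potential a Δ d D ℓ m (advance ℓ false s) ≤ potential a Δ d D ℓ m s - 1 := by
      rw [advance_false hs, e]
      split_ifs with hw
      · simp only [potential, hI, hJ, if_false]
        push_cast
        linarith
      · refine (potential_startRound_le h hJ (by simp) le_rfl).trans ?_
        rw [List.idxOf_append_of_mem haq]
        -- A reset of the counter only shortens the rounds ahead, so the potential may assume that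
        -- the incumbent keeps winning.
        have := passBound_mono (D := D) h.m_mono (s.queue.idxOf a) (show 1 ≤ s.c + 1 by omega)
        linarith
    rw [stateRegret, if_neg (by tauto)]
    nlinarith [mul_le_mul_of_nonneg_left hT hp0, mul_le_mul_of_nonneg_left hF hp1]

end Drift

end BtWR

/-! ### Random variables with finitely many values -/

section FiniteRange

variable {Ω : Type*} [MeasurableSpace Ω] {μ : Measure Ω} [IsProbabilityMeasure μ]
  {α β : Type*} [Finite α] [MeasurableSpace α] [MeasurableSingletonClass α]
  [Finite β] [MeasurableSpace β] [MeasurableSingletonClass β]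

lemma integrable_comp_of_finite {Y : Ω → α} (hY : Measurable Y) (F : α → ℝ) :
    Integrable (fun ω => F (Y ω)) μ := by
  have : IsProbabilityMeasure (μ.map Y) := Measure.isProbabilityMeasure_map hY.aemeasurable
  exact (Integrable.of_finite : Integrable F (μ.map Y)).comp_measurable hY

/-- Fubini for the joint law. Finite value types suffice because everything up to a fixed time is a
function of finitely many Booleans and the start; no σ-algebra on `State K` is needed. -/
lemma integral_indepFun_of_finite {Y : Ω → α} {Z : Ω → β} (hY : Measurable Y) (hZ : Measurable Z)
    (h : IndepFun Y Z μ) (F : α → β → ℝ) :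
    ∫ ω, F (Y ω) (Z ω) ∂μ = ∫ ω, ∫ ω', F (Y ω) (Z ω') ∂μ ∂μ := by
  have : IsProbabilityMeasure (μ.map Y) := Measure.isProbabilityMeasure_map hY.aemeasurable
  have : IsProbabilityMeasure (μ.map Z) := Measure.isProbabilityMeasure_map hZ.aemeasurable
  have h1 : ∫ ω, F (Y ω) (Z ω) ∂μ = ∫ p, F p.1 p.2 ∂(μ.map fun ω => (Y ω, Z ω)) :=
    (integral_map (f := fun p : α × β => F p.1 p.2) (hY.prodMk hZ).aemeasurable
      (measurable_of_finite _).aestronglyMeasurable).symm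
  rw [h1, h.map_prod_eq_prod_map_map hY.aemeasurable hZ.aemeasurable,
    integral_prod _ Integrable.of_finite,
    integral_map hY.aemeasurable (measurable_of_finite _).aestronglyMeasurable]
  refine integral_congr_ae (.of_forall fun ω => ?_)
  exact integral_map hZ.aemeasurable (measurable_of_finite _).aestronglyMeasurable

lemma integral_comp_bool {B : Ω → Bool} (hB : Measurable B) {p : ℝ} (hp : 0 ≤ p)
    (h : μ {ω | B ω = true} = ENNReal.ofReal p) (f : Bool → ℝ) :
    ∫ ω, f (B ω) ∂μ = p * f true + (1 - p) * f false := by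
  have hm : MeasurableSet {ω | B ω = true} := hB (measurableSet_singleton true)
  have e : (fun ω => f (B ω))
      = fun ω => f false + {ω | B ω = true}.indicator (fun _ => f true - f false) ω := by
    funext ω
    cases hb : B ω <;> simp [Set.indicator, hb]
  rw [e, integral_add (integrable_const _) ((integrable_const _).indicator hm),
    integral_indicator_const _ hm, Measure.real, h, ENNReal.toReal_ofReal hp]
  simp
  ring

end FiniteRange

/-! ### The uniform start -/

/-- The `K * (K - 1)!` admissible starts are disjoint events of equal mass `1 / (K * (K - 1)!)`, so
they leave no mass for any other start. -/
lemma IsUniformStart.ae_injective {K : ℕ} (hK : 2 ≤ K) {Ω : Type*} [MeasurableSpace Ω]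
    {μ : Measure Ω} [IsProbabilityMeasure μ] {I : Ω → Fin K} {Q : Ω → Fin (K - 1) → Fin K}
    (h : IsUniformStart μ I Q) :
    ∀ᵐ ω ∂μ, Function.Injective (Q ω) ∧ ∀ k, Q ω k ≠ I ω := by
  let E : (Σ i : Fin K, (Fin (K - 1) ↪ {x : Fin K // x ≠ i})) → Set Ω :=
    fun p => {ω | I ω = p.1 ∧ Q ω = fun k => (p.2 k : Fin K)}
  have hE : ∀ p, MeasurableSet (E p) := fun p =>
    (h.measurable_incumbent (measurableSet_singleton p.1)).inter
      (h.measurable_queue (measurableSet_singleton _))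
  have hdisj : Pairwise (Function.onFun Disjoint E) := by
    rintro ⟨i, e⟩ ⟨i', e'⟩ hne
    refine Set.disjoint_left.2 fun ω h1 h2 => hne ?_
    obtain rfl : i = i' := h1.1.symm.trans h2.1
    have : e = e' := by
      ext k
      exact congrArg Fin.val (congrFun (h1.2.symm.trans h2.2) k)
    rw [this]
  have hcard : Fintype.card (Σ i : Fin K, (Fin (K - 1) ↪ {x : Fin K // x ≠ i}))
      = K * (K - 1).factorial := by
    simp [Fintype.card_sigma, Fintype.card_embedding_eq, Fintype.card_subtype_compl,
      Nat.descFactorial_self]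
  have hμ : μ (⋃ p, E p) = 1 := by
    rw [measure_iUnion hdisj hE, tsum_fintype, Finset.sum_congr rfl fun p _ =>
      h.uniform p.1 (fun k => (p.2 k : Fin K)) (Subtype.val_injective.comp p.2.injective)
        fun k => (p.2 k).2]
    rw [Finset.sum_const, Finset.card_univ, hcard, nsmul_eq_mul, Nat.cast_mul]
    have h1 : (K : ENNReal) ≠ 0 := by simp; omega
    have h2 : ((K - 1).factorial : ENNReal) ≠ 0 := by
      simpa using Nat.factorial_ne_zero (K - 1)
    rw [mul_mul_mul_comm, ENNReal.mul_inv_cancel h1 (by simp),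
      ENNReal.mul_inv_cancel h2 (by simp), one_mul]
  have hae : ∀ᵐ ω ∂μ, ω ∈ ⋃ p, E p :=
    (prob_compl_eq_zero_iff (MeasurableSet.iUnion hE)).2 hμ
  filter_upwards [hae] with ω hω
  obtain ⟨⟨i, e⟩, hi, hq⟩ := Set.mem_iUnion.1 hω
  simp only at hi hq
  rw [hi, hq]
  exact ⟨Subtype.val_injective.comp e.injective, fun k => (e k).2⟩

/-! ### Gaps and regret -/

section Gap

variable {K : ℕ} {P : Matrix (Fin K) (Fin K) ℝ} {a : Fin K}

lemma exists_minGap_eq (hK : 2 ≤ K) (P : Matrix (Fin K) (Fin K) ℝ) (a : Fin K) :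
    ∃ i, i ≠ a ∧ gap P a i = minGap P a := by
  have : Nontrivial (Fin K) := Fin.nontrivial_iff_two_le.2 hK
  obtain ⟨j, hj⟩ := exists_ne a
  have : Nonempty {i : Fin K // i ≠ a} := ⟨⟨j, hj⟩⟩
  obtain ⟨i, hi⟩ := exists_eq_ciInf_of_finite (f := fun i : {i : Fin K // i ≠ a} => gap P a i)
  exact ⟨i, i.2, hi⟩

lemma minGap_le {i : Fin K} (hi : i ≠ a) : minGap P a ≤ gap P a i :=
  ciInf_le (f := fun i : {i : Fin K // i ≠ a} => gap P a i) (Set.finite_range _).bddBelow ⟨i, hi⟩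

lemma IsCondorcetWinner.minGap_pos (ha : IsCondorcetWinner P a) (hK : 2 ≤ K) :
    0 < minGap P a := by
  obtain ⟨i, hi, h⟩ := exists_minGap_eq hK P a
  rw [← h]
  exact sub_pos.2 (ha i hi)

lemma IsPreferenceMatrix.gap_le (hP : IsPreferenceMatrix P) (i : Fin K) : gap P a i ≤ 1 / 2 := by
  have := (hP.mem_Icc a i).2
  unfold gap
  linarith

lemma IsPreferenceMatrix.minGap_le_half (hP : IsPreferenceMatrix P) (hK : 2 ≤ K) :
    minGap P a ≤ 1 / 2 := by
  obtain ⟨i, -, h⟩ := exists_minGap_eq hK P a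
  exact h ▸ hP.gap_le i

lemma IsPreferenceMatrix.gap_self (hP : IsPreferenceMatrix P) : gap P a a = 0 := by
  have := hP.add_eq_one a a
  unfold gap
  linarith

lemma IsCondorcetWinner.gap_nonneg (ha : IsCondorcetWinner P a) (hP : IsPreferenceMatrix P)
    (i : Fin K) : 0 ≤ gap P a i := by
  by_cases hi : i = a
  · rw [hi, hP.gap_self]
  · exact (sub_pos.2 (ha i hi)).le

/-- The gap of `a` is 0 and all others lie in `(0, 1/2]`, so the ceiling takes only the values 0 and
1. -/
lemma binaryWeakRegret_eq (hP : IsPreferenceMatrix P) (ha : IsCondorcetWinner P a)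
    (i j : Fin K) :
    (binaryWeakRegret P a i j : ℝ) = if i = a ∨ j = a then 0 else 1 := by
  unfold binaryWeakRegret weakRegret
  split_ifs with h
  · have : min (gap P a i) (gap P a j) = 0 := by
      rcases h with rfl | rfl
      · rw [hP.gap_self, min_eq_left (ha.gap_nonneg hP j)]
      · rw [hP.gap_self, min_eq_right (ha.gap_nonneg hP i)]
    simp [this]
  · rw [not_or] at h
    have h1 : ⌈min (gap P a i) (gap P a j)⌉ = 1 := by
      rw [Int.ceil_eq_iff]
      have hi := ha i h.1
      have hj := ha j h.2
      refine ⟨?_, (min_le_left _ _).trans ?_⟩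
      · simpa [gap] using And.intro hi hj
      · have := hP.gap_le (a := a) i
        push_cast
        linarith
    simp [h1]

end Gap

namespace BtWR

/-! ### The round lengths -/

/-- Bound for the duration of a round with counter `c`. -/
noncomputable def durationBound (Δ : ℝ) (c : ℕ) : ℝ :=
  (Real.log ((c : ℝ) * (c + 1)) + 2) / (2 * Δ ^ 2)

lemma log_mul_succ_nonneg (c : ℕ) : 0 ≤ Real.log ((c : ℝ) * (c + 1)) := by
  exact_mod_cast Real.log_natCast_nonneg (c * (c + 1))

lemma durationBound_nonneg (Δ : ℝ) (c : ℕ) : 0 ≤ durationBound Δ c :=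
  div_nonneg (by linarith [log_mul_succ_nonneg c]) (by positivity)

lemma durationBound_mono (Δ : ℝ) : Monotone (durationBound Δ) := by
  intro c c' h
  have : Real.log ((c : ℝ) * (c + 1)) ≤ Real.log ((c' : ℝ) * (c' + 1)) := by
    -- At `c = 0` the convention `Real.log 0 = 0` keeps the bound monotone.
    rcases Nat.eq_zero_or_pos c with rfl | hc
    · simpa using log_mul_succ_nonneg c'
    · have hc' : (0 : ℝ) < c := by exact_mod_cast hc
      gcongr
  unfold durationBound
  gcongr

lemma log_roundLength {c : ℕ} (hc : 1 ≤ c) :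
    Real.log ((c : ℝ) * ((c : ℝ) + 1) * Real.exp 1 / (1 / Real.exp 1))
      = Real.log ((c : ℝ) * (c + 1)) + 2 := by
  have hc' : (0 : ℝ) < c := by exact_mod_cast hc
  rw [div_div_eq_mul_div, div_one, mul_assoc _ (Real.exp 1), ← Real.exp_add,
    Real.log_mul (by positivity) (Real.exp_pos _).ne', Real.log_exp]
  norm_num

section RoundLength

variable {Δ : ℝ} {c : ℕ}

lemma two_mul_arg_roundLength (h0 : 0 < Δ) (hc : 1 ≤ c) :
    2 * (1 / (4 * Δ ^ 2) * Real.log ((c : ℝ) * ((c : ℝ) + 1) * Real.exp 1 / (1 / Real.exp 1))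
      - 1 / 2) = durationBound Δ c - 1 := by
  rw [log_roundLength hc, durationBound]
  field_simp
  ring

lemma four_le_durationBound (h0 : 0 < Δ) (h1 : Δ ≤ 1 / 2) (c : ℕ) : 4 ≤ durationBound Δ c := by
  have := log_mul_succ_nonneg c
  rw [durationBound, le_div_iff₀ (by positivity)]
  nlinarith

lemma durationBound_le_roundLength (h0 : 0 < Δ) (hc : 1 ≤ c) :
    durationBound Δ c - 1 ≤ 2 * (roundLength Δ (1 / Real.exp 1) c : ℝ) := by
  rw [← two_mul_arg_roundLength h0 hc]
  exact mul_le_mul_of_nonneg_left (Nat.le_ceil _) (by norm_num)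

lemma roundLength_le (h0 : 0 < Δ) (h1 : Δ ≤ 1 / 2) (hc : 1 ≤ c) :
    2 * (roundLength Δ (1 / Real.exp 1) c : ℝ) - 1 ≤ durationBound Δ c := by
  have h4 := four_le_durationBound h0 h1 c
  have h := two_mul_arg_roundLength h0 hc
  have := Nat.ceil_lt_add_one (a := 1 / (4 * Δ ^ 2)
    * Real.log ((c : ℝ) * ((c : ℝ) + 1) * Real.exp 1 / (1 / Real.exp 1)) - 1 / 2) (by linarith)
  unfold roundLength
  linarith

lemma roundLength_pos (h0 : 0 < Δ) (h1 : Δ ≤ 1 / 2) (hc : 1 ≤ c) :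
    0 < roundLength Δ (1 / Real.exp 1) c := by
  have h4 := four_le_durationBound h0 h1 c
  have h := durationBound_le_roundLength h0 hc
  have : (0 : ℝ) < roundLength Δ (1 / Real.exp 1) c := by linarith
  exact_mod_cast this

/-- Rounding and the `-1/2` in the round length cost `4 * Δ ^ 2 ≤ 1` in the exponent; the factor `e`
inside the logarithm compensates for it. -/
lemma raceBound_roundLength_le (h0 : 0 < Δ) (h1 : Δ ≤ 1 / 2) (hc : 1 ≤ c) :
    raceBound Δ (roundLength Δ (1 / Real.exp 1) c) 0 0
      ≤ 1 / Real.exp 1 / ((c : ℝ) * (c + 1)) := by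
  have hc' : (0 : ℝ) < c := by exact_mod_cast hc
  have h := durationBound_le_roundLength h0 hc
  have e : 2 * Δ ^ 2 * durationBound Δ c = Real.log ((c : ℝ) * (c + 1)) + 2 := by
    unfold durationBound
    field_simp
  have hR : 1 / Real.exp 1 / ((c : ℝ) * (c + 1))
      = Real.exp (-1 - Real.log ((c : ℝ) * (c + 1))) := by
    rw [Real.exp_sub, Real.exp_log (by positivity), Real.exp_neg, one_div]
  rw [hR]
  refine Real.exp_le_exp.2 ?_
  have h2 := mul_le_mul_of_nonneg_left h (by positivity : 0 ≤ 2 * Δ ^ 2)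
  push_cast
  nlinarith

end RoundLength

/-! ### Numerical constants and the choice of `D` -/

section Constants

variable {K : ℕ} {Δ : ℝ}

/-- Separates `K` from `c` by `(c + K - 2)(c + K - 1) ≤ K ^ 2 * c (c + 1)`. -/
lemma durationBound_add_le (h0 : 0 < Δ) (hK : 2 ≤ K) {c : ℕ} (hc : 1 ≤ c) :
    durationBound Δ (c + (K - 2))
      ≤ (Real.log K + (Real.log ((c : ℝ) * (c + 1)) + 2) / 2) / Δ ^ 2 := by
  have hc' : (1 : ℝ) ≤ c := by exact_mod_cast hc
  have hK' : (2 : ℝ) ≤ K := by exact_mod_cast hK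
  have hlog : Real.log (((c + (K - 2) : ℕ) : ℝ) * ((c + (K - 2) : ℕ) + 1))
      ≤ 2 * Real.log K + Real.log ((c : ℝ) * (c + 1)) := by
    rw [← Real.log_rpow (by positivity), ← Real.log_mul (by positivity) (by positivity)]
    push_cast [Nat.cast_sub hK]
    refine Real.log_le_log (by nlinarith) ?_
    rw [show (K : ℝ) ^ (2 : ℝ) = K ^ 2 by exact_mod_cast Real.rpow_natCast (K : ℝ) 2]
    have h1 : (c : ℝ) + (K - 2) ≤ K * c := by nlinarith
    have h2 : (c : ℝ) + (K - 2) + 1 ≤ K * (c + 1) := by nlinarith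
    calc ((c : ℝ) + (K - 2)) * (c + (K - 2) + 1) ≤ (K * c) * (K * (c + 1)) := by
          apply mul_le_mul h1 h2 <;> nlinarith
      _ = K ^ 2 * (c * (c + 1)) := by ring
  unfold durationBound
  rw [div_le_div_iff₀ (by positivity) (by positivity)]
  have := mul_le_mul_of_nonneg_right hlog (by positivity : 0 ≤ Δ ^ 2)
  nlinarith

lemma durationBound_sub_two_le (h0 : 0 < Δ) (hK : 2 ≤ K) :
    durationBound Δ (K - 2) ≤ (Real.log K + 1) / Δ ^ 2 := by
  have hK' : (2 : ℝ) ≤ K := by exact_mod_cast hK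
  have hlog : Real.log (((K - 2 : ℕ) : ℝ) * ((K - 2 : ℕ) + 1)) ≤ 2 * Real.log K := by
    rcases Nat.eq_zero_or_pos (K - 2) with h | h
    · rw [h]
      simpa using Real.log_natCast_nonneg K
    · have h' : (0 : ℝ) < (K - 2 : ℕ) := by exact_mod_cast h
      rw [← Real.log_rpow (by positivity)]
      refine Real.log_le_log (by positivity) ?_
      rw [show (K : ℝ) ^ (2 : ℝ) = K ^ 2 by exact_mod_cast Real.rpow_natCast (K : ℝ) 2]
      push_cast [Nat.cast_sub hK]
      nlinarith
  unfold durationBound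
  rw [div_le_div_iff₀ (by positivity) (by positivity)]
  have := mul_le_mul_of_nonneg_right hlog (by positivity : 0 ≤ Δ ^ 2)
  nlinarith

/-- Bound for the expected regret from the time at which the best arm is the challenger. -/
noncomputable def regretConst (K : ℕ) (Δ : ℝ) : ℝ :=
  4 * ((K - 2 : ℕ) : ℝ) * Real.log K / Δ ^ 2

lemma regretConst_nonneg (K : ℕ) (Δ : ℝ) : 0 ≤ regretConst K Δ := by
  have := Real.log_natCast_nonneg K
  unfold regretConst
  positivity

lemma log_natCast_ge (hK : 2 ≤ K) : 0.69 ≤ Real.log K := by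
  have h : Real.log 2 ≤ Real.log K := Real.log_le_log (by norm_num) (by exact_mod_cast hK)
  linarith [Real.log_two_gt_d9]

lemma passBound_one_le (h0 : 0 < Δ) (hK : 2 ≤ K) :
    passBound (durationBound Δ) (regretConst K Δ) (K - 2) 1
      ≤ ((K - 2 : ℕ) : ℝ) * (5 * Real.log K + 1) / Δ ^ 2 := by
  have h := passBound_succ_le (D := regretConst K Δ) (durationBound_mono Δ) (K - 2) 0
  have h2 := mul_le_mul_of_nonneg_left (durationBound_sub_two_le h0 hK)
    (Nat.cast_nonneg (α := ℝ) (K - 2))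
  rw [zero_add, zero_add] at h
  refine (h.trans (add_le_add_left h2 _)).trans (le_of_eq ?_)
  unfold regretConst
  ring

lemma passBound_div_le (h0 : 0 < Δ) (hK : 2 ≤ K) {c : ℕ} (hc : 1 ≤ c) :
    passBound (durationBound Δ) (regretConst K Δ) (K - 2) (c + 1) / ((c : ℝ) * (c + 1))
      ≤ ((K - 2 : ℕ) : ℝ) * (5 / 2 * Real.log K + 3 / 4) / Δ ^ 2 := by
  have hc' : (1 : ℝ) ≤ c := by exact_mod_cast hc
  have hx : (2 : ℝ) ≤ (c : ℝ) * (c + 1) := by nlinarith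
  have hκ := log_natCast_ge hK
  have h := passBound_succ_le (D := regretConst K Δ) (durationBound_mono Δ) (K - 2) c
  have h2 := mul_le_mul_of_nonneg_left (durationBound_add_le h0 hK hc)
    (Nat.cast_nonneg (α := ℝ) (K - 2))
  -- With `x = c (c + 1) ≥ 2`: `5 log K ≤ (5/2) x log K`, and `(log x + 2) / 2 ≤ (x + 1) / 2 ≤ (3/4)
  -- x`.
  have hlog := Real.log_le_sub_one_of_pos (by linarith : (0 : ℝ) < (c : ℝ) * (c + 1))
  generalize (c : ℝ) * (c + 1) = x at *
  rw [div_le_iff₀ (by linarith)]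
  refine (h.trans (add_le_add_left h2 _)).trans ?_
  have e : ((K - 2 : ℕ) : ℝ) * ((Real.log K + (Real.log x + 2) / 2) / Δ ^ 2) + regretConst K Δ
      = ((K - 2 : ℕ) : ℝ) / Δ ^ 2 * (5 * Real.log K + (Real.log x + 2) / 2) := by
    unfold regretConst
    ring
  rw [e, show ((K - 2 : ℕ) : ℝ) * (5 / 2 * Real.log K + 3 / 4) / Δ ^ 2 * x
    = ((K - 2 : ℕ) : ℝ) / Δ ^ 2 * ((5 / 2 * Real.log K + 3 / 4) * x) by ring]
  refine mul_le_mul_of_nonneg_left ?_ (by positivity)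
  nlinarith

lemma driftData_roundLength (hK : 2 ≤ K) (h0 : 0 < Δ) (h1 : Δ ≤ 1 / 2) :
    DriftData K Δ (1 / Real.exp 1) (regretConst K Δ) (roundLength Δ (1 / Real.exp 1))
      (durationBound Δ) where
  gap_nonneg := h0.le
  gap_le := h1
  d_nonneg := by positivity
  D_nonneg := regretConst_nonneg K Δ
  m_nonneg := durationBound_nonneg Δ
  m_mono := durationBound_mono Δ
  length_pos _ hc := roundLength_pos h0 h1 hc
  length_le _ hc := roundLength_le h0 h1 hc
  race_le _ hc := raceBound_roundLength_le h0 h1 hc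
  le_D c hc := by
    have hκ := log_natCast_ge hK
    have hd : 1 / Real.exp 1 ≤ 0.37 := by
      rw [div_le_iff₀ (Real.exp_pos _)]
      linarith [Real.exp_one_gt_d9]
    have hd0 : 0 ≤ 1 / Real.exp 1 := by positivity
    generalize 1 / Real.exp 1 = d at *
    have hN : 0 ≤ ((K - 2 : ℕ) : ℝ) / Δ ^ 2 := by positivity
    calc d / (c * (c + 1)) * passBound (durationBound Δ) (regretConst K Δ) (K - 2) (c + 1)
          + d * passBound (durationBound Δ) (regretConst K Δ) (K - 2) 1
        = d * (passBound (durationBound Δ) (regretConst K Δ) (K - 2) (c + 1) / (c * (c + 1))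
          + passBound (durationBound Δ) (regretConst K Δ) (K - 2) 1) := by ring
      _ ≤ d * (((K - 2 : ℕ) : ℝ) * (5 / 2 * Real.log K + 3 / 4) / Δ ^ 2
          + ((K - 2 : ℕ) : ℝ) * (5 * Real.log K + 1) / Δ ^ 2) :=
        mul_le_mul_of_nonneg_left
          (add_le_add (passBound_div_le h0 hK hc) (passBound_one_le h0 hK)) hd0
      _ = ((K - 2 : ℕ) : ℝ) / Δ ^ 2 * (d * (15 / 2 * Real.log K + 7 / 4)) := by ring
      -- `0.37 * (7.5 κ + 1.75) ≤ 4 κ` for `κ = log K ≥ 0.69`; this is where the 4 in `regretConst`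
      -- suffices.
      _ ≤ ((K - 2 : ℕ) : ℝ) / Δ ^ 2 * (4 * Real.log K) := by
        refine mul_le_mul_of_nonneg_left ?_ hN
        nlinarith
      _ = regretConst K Δ := by unfold regretConst; ring

lemma passBound_one_le_mul_log (h0 : 0 < Δ) (hK : 2 ≤ K) :
    passBound (durationBound Δ) (regretConst K Δ) (K - 2) 1
      ≤ 20 * (K : ℝ) * Real.log K / Δ ^ 2 := by
  have hκ := log_natCast_ge hK
  refine (passBound_one_le h0 hK).trans ?_
  have hN : ((K - 2 : ℕ) : ℝ) ≤ K := by exact_mod_cast Nat.sub_le K 2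
  have h2 : ((K - 2 : ℕ) : ℝ) * (5 * Real.log K + 1) ≤ K * (20 * Real.log K) :=
    mul_le_mul hN (by linarith) (by linarith) (by positivity)
  gcongr ?_ / _
  linarith

end Constants

/-! ### The run of the algorithm -/

section Run

variable {K : ℕ} {ℓ : ℕ → ℕ} {i : Fin K} {q : Fin (K - 1) → Fin K}

lemma run_congr {x x' : ℕ → Fin K → Fin K → Bool} {t : ℕ} (h : ∀ s < t, x s = x' s) :
    run ℓ i q x t = run ℓ i q x' t := by
  induction t with
  | zero => rfl
  | succ t ih => rw [run, run, ih fun s hs => h s (by omega), h t (by omega)]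

lemma valid_run (hℓ : ∀ c, 1 ≤ c → 0 < ℓ c) (hK : 2 ≤ K) (hq : Function.Injective q)
    (hi : ∀ k, q k ≠ i) (x : ℕ → Fin K → Fin K → Bool) (t : ℕ) : (run ℓ i q x t).Valid ℓ := by
  induction t with
  | zero =>
    refine valid_startRound hℓ hK (List.nodup_cons.2 ⟨?_, List.nodup_ofFn.2 hq⟩) ?_ le_rfl
    · simpa [List.mem_ofFn] using hi
    · rw [List.length_ofFn]
      omega
  | succ t ih => exact ih.advance hℓ _

/-- The expectation of `f` after one more duel in state `s`. -/
noncomputable def expectedNext (P : Matrix (Fin K) (Fin K) ℝ) (ℓ : ℕ → ℕ) (f : State K → ℝ)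
    (s : State K) : ℝ :=
  P s.incumbent s.challenger * f (advance ℓ true s)
    + (1 - P s.incumbent s.challenger) * f (advance ℓ false s)

/-- The feedback sequence that is `false` after the given initial segment. -/
def extendFeedback {t : ℕ} (y : Finset.range t → Fin K → Fin K → Bool) :
    ℕ → Fin K → Fin K → Bool :=
  fun s => if h : s ∈ Finset.range t then y ⟨s, h⟩ else fun _ _ => false

lemma run_extendFeedback {T t : ℕ} (ht : t ≤ T) (x : ℕ → Fin K → Fin K → Bool) :
    run ℓ i q (extendFeedback fun s : Finset.range T => x s) t = run ℓ i q x t :=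
  run_congr fun s hs => by
    have : s ∈ Finset.range T := Finset.mem_range.2 (by omega)
    simp only [extendFeedback, this, dif_pos]

variable {Ω : Type*} [MeasurableSpace Ω] {μ : Measure Ω} {X : ℕ → Fin K → Fin K → Ω → Bool}

lemma measurable_history {P : Matrix (Fin K) (Fin K) ℝ} (hX : IsDuelFeedback P μ X) (t : ℕ) :
    Measurable fun ω (s : Finset.range t) i j => X s i j ω :=
  measurable_pi_lambda _ fun s => measurable_pi_lambda _ fun i => measurable_pi_lambda _ fun j =>
    hX.measurable s i j

variable [IsProbabilityMeasure μ]

lemma integrable_run {P : Matrix (Fin K) (Fin K) ℝ} (hX : IsDuelFeedback P μ X)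
    (f : State K → ℝ) (t : ℕ) :
    Integrable (fun ω => f (run ℓ i q (fun t i j => X t i j ω) t)) μ := by
  have := integrable_comp_of_finite (μ := μ) (measurable_history hX t)
    fun y => f (run ℓ i q (extendFeedback y) t)
  refine this.congr (.of_forall fun ω => ?_)
  exact congrArg f (run_extendFeedback le_rfl fun t i j => X t i j ω)

/-- The Markov property: the expectation over the next duel given the past. -/
lemma integral_run_succ {P : Matrix (Fin K) (Fin K) ℝ} (hP : IsPreferenceMatrix P)
    (hX : IsDuelFeedback P μ X) (f : State K → ℝ) (t : ℕ) :
    ∫ ω, f (run ℓ i q (fun t i j => X t i j ω) (t + 1)) ∂μ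
      = ∫ ω, expectedNext P ℓ f (run ℓ i q (fun t i j => X t i j ω) t) ∂μ := by
  have hXt : Measurable fun ω i j => X t i j ω :=
    measurable_pi_lambda _ fun i => measurable_pi_lambda _ fun j => hX.measurable t i j
  have hind : IndepFun (fun ω (s : Finset.range t) i j => X s i j ω)
      (fun ω i j => X t i j ω) μ := by
    have h := hX.indep.indepFun_finset (Finset.range t) {t} (by simp) fun s =>
      measurable_pi_lambda _ fun i => measurable_pi_lambda _ fun j => hX.measurable s i j
    exact h.comp measurable_id
      (measurable_pi_apply (⟨t, Finset.mem_singleton_self t⟩ : ({t} : Finset ℕ)))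
  have hrun := fun ω => run_extendFeedback (ℓ := ℓ) (i := i) (q := q) (le_refl t)
    fun t i j => X t i j ω
  calc ∫ ω, f (run ℓ i q (fun t i j => X t i j ω) (t + 1)) ∂μ
      = ∫ ω, f (step ℓ (fun i j => X t i j ω)
          (run ℓ i q (extendFeedback fun s : Finset.range t => fun i j => X s i j ω) t)) ∂μ :=
        integral_congr_ae (.of_forall fun ω => by simp only [hrun ω]; rfl)
    -- The past is frozen and fresh feedback integrated; the pair played is then fixed and a single
    -- Bernoulli entry remains.
    _ = ∫ ω, ∫ ω', f (step ℓ (fun i j => X t i j ω')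
          (run ℓ i q (extendFeedback fun s : Finset.range t => fun i j => X s i j ω) t)) ∂μ ∂μ :=
        integral_indepFun_of_finite (measurable_history hX t) hXt hind
          fun y z => f (step ℓ z (run ℓ i q (extendFeedback y) t))
    _ = _ := by
        refine integral_congr_ae (.of_forall fun ω => ?_)
        simp only [hrun ω, step_eq_advance]
        exact integral_comp_bool (hX.measurable t _ _) (hP.mem_Icc _ _).1 (hX.bernoulli t _ _)
          fun b => f (advance ℓ b (run ℓ i q (fun t i j => X t i j ω) t))

variable {a : Fin K} {Δ d D : ℝ} {m : ℕ → ℝ}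

/-- Regret so far plus current potential is nonincreasing in expectation, by `potential_drift` and
the Markov property. -/
lemma sum_integral_regret_le (h : DriftData K Δ d D ℓ m) {P : Matrix (Fin K) (Fin K) ℝ}
    (hP : IsPreferenceMatrix P) (hgap : ∀ i, i ≠ a → 1 / 2 + Δ ≤ P a i)
    (hX : IsDuelFeedback P μ X) (hK : 2 ≤ K) (hq : Function.Injective q) (hi : ∀ k, q k ≠ i)
    (T : ℕ) :
    ∑ t ∈ Finset.range T, ∫ ω, stateRegret a (run ℓ i q (fun t i j => X t i j ω) t) ∂μ
      + ∫ ω, potential a Δ d D ℓ m (run ℓ i q (fun t i j => X t i j ω) T) ∂μ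
      ≤ potential a Δ d D ℓ m (startRound i (List.ofFn q) 1) := by
  induction T with
  | zero => simp [run]
  | succ T ih =>
    refine le_trans ?_ ih
    rw [Finset.sum_range_succ, add_assoc, integral_run_succ hP hX]
    refine add_le_add_right ?_ _
    rw [← integral_add (integrable_run hX (stateRegret a) T)
      (integrable_run hX (expectedNext P ℓ _) T)]
    refine integral_mono ((integrable_run hX (stateRegret a) T).add
      (integrable_run hX (expectedNext P ℓ _) T)) (integrable_run hX _ T) fun ω => ?_
    exact potential_drift h hP hgap (valid_run h.length_pos hK hq hi _ T)

lemma potential_start_le (h : DriftData K Δ d D ℓ m) (hd : d ≤ 1) (hK : 2 ≤ K)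
    (hq : Function.Injective q) (hi : ∀ k, q k ≠ i) :
    potential a Δ d D ℓ m (startRound i (List.ofFn q) 1) ≤ passBound m D (K - 2) 1 := by
  by_cases hia : i = a
  · rw [hia]
    refine (potential_startRound_self_le h _ le_rfl).trans ?_
    rw [Nat.cast_one, div_one]
    exact mul_le_of_le_one_left (h.passBound_nonneg _ _) hd
  · have hne : List.ofFn q ≠ [] := by
      rw [Ne, List.ofFn_eq_nil_iff]
      omega
    refine (potential_startRound_le h hia hne le_rfl).trans ?_
    have hv : a ∈ List.ofFn q := by
      -- Incumbent and queue together are `K` distinct arms, hence all arms.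
      have hinj : Function.Injective fun k : Option (Fin (K - 1)) => k.elim i q := by
        rintro (_ | k) (_ | k') hk
        · rfl
        · exact absurd hk.symm (hi k')
        · exact absurd hk (hi k)
        · exact congrArg some (hq hk)
      have hbij := (Fintype.bijective_iff_injective_and_card _).2 ⟨hinj, by
        simp only [Fintype.card_option, Fintype.card_fin]
        omega⟩
      obtain ⟨_ | k, hk⟩ := hbij.2 a
      · exact absurd hk hia
      · exact (List.mem_ofFn' q a).2 ⟨k, hk⟩
    have hlt := List.idxOf_lt_length_of_mem hv
    rw [List.length_ofFn] at hlt
    exact passBound_mono_left h.m_mono h.m_nonneg 1 (by omega)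

end Run

/-! ### The regret bound for a fixed start -/

lemma cumBinaryWeakRegret_eq {K : ℕ} {P : Matrix (Fin K) (Fin K) ℝ} {a : Fin K}
    (hP : IsPreferenceMatrix P) (ha : IsCondorcetWinner P a) (ℓ : ℕ → ℕ) (i : Fin K)
    (q : Fin (K - 1) → Fin K) (x : ℕ → Fin K → Fin K → Bool) (T : ℕ) :
    (cumBinaryWeakRegret P a ℓ i q x T : ℝ) = ∑ t ∈ Finset.range T, stateRegret a (run ℓ i q x t) := by
  unfold cumBinaryWeakRegret
  push_cast
  exact Finset.sum_congr rfl fun t _ => binaryWeakRegret_eq hP ha _ _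

lemma cumBinaryWeakRegret_extendFeedback {K : ℕ} (P : Matrix (Fin K) (Fin K) ℝ) (a : Fin K)
    (ℓ : ℕ → ℕ) (i : Fin K) (q : Fin (K - 1) → Fin K) (x : ℕ → Fin K → Fin K → Bool) (T : ℕ) :
    cumBinaryWeakRegret P a ℓ i q (extendFeedback fun s : Finset.range T => x s) T
      = cumBinaryWeakRegret P a ℓ i q x T := by
  unfold cumBinaryWeakRegret
  refine Finset.sum_congr rfl fun t ht => ?_
  rw [run_extendFeedback (Finset.mem_range.1 ht).le]

lemma integral_cumBinaryWeakRegret_le {K : ℕ} (hK : 2 ≤ K) {P : Matrix (Fin K) (Fin K) ℝ}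
    (hP : IsPreferenceMatrix P) {a : Fin K} (ha : IsCondorcetWinner P a)
    {Ω : Type*} [MeasurableSpace Ω] {μ : Measure Ω} [IsProbabilityMeasure μ]
    {X : ℕ → Fin K → Fin K → Ω → Bool} (hX : IsDuelFeedback P μ X) {i : Fin K}
    {q : Fin (K - 1) → Fin K} (hq : Function.Injective q) (hi : ∀ k, q k ≠ i) (T : ℕ) :
    ∫ ω, (cumBinaryWeakRegret P a (roundLength (minGap P a) (1 / Real.exp 1)) i q
        (fun t i j => X t i j ω) T : ℝ) ∂μ
      ≤ 20 * (K : ℝ) * Real.log K / minGap P a ^ 2 := by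
  have h0 := ha.minGap_pos hK
  have hD := driftData_roundLength hK h0 (hP.minGap_le_half hK)
  have hgap : ∀ i, i ≠ a → 1 / 2 + minGap P a ≤ P a i := fun i hi => by
    have := minGap_le (P := P) hi
    unfold gap at this
    linarith
  have hsum := sum_integral_regret_le (a := a) hD hP hgap hX hK hq hi T
  have hpos : 0 ≤ ∫ ω, potential a (minGap P a) (1 / Real.exp 1) (regretConst K (minGap P a))
      (roundLength (minGap P a) (1 / Real.exp 1)) (durationBound (minGap P a))
      (run (roundLength (minGap P a) (1 / Real.exp 1)) i q (fun t i j => X t i j ω) T) ∂μ :=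
    integral_nonneg fun ω => potential_nonneg hD (valid_run hD.length_pos hK hq hi _ T)
  have hd : 1 / Real.exp 1 ≤ 1 := by
    rw [div_le_one (Real.exp_pos _)]
    exact Real.one_le_exp zero_le_one
  simp only [cumBinaryWeakRegret_eq hP ha]
  rw [integral_finsetSum _ fun t _ => integrable_run hX (stateRegret a) t]
  have hstart := potential_start_le (a := a) hD hd hK hq hi
  have hfin := passBound_one_le_mul_log h0 hK
  linarith

end BtWR

/-! ### Averaging over the random start -/

theorem theorem1 {K : ℕ} (hK : 2 ≤ K)
    (P : Matrix (Fin K) (Fin K) ℝ) (hP : IsPreferenceMatrix P)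
    (a : Fin K) (ha : IsCondorcetWinner P a)
    {Ω : Type*} [MeasurableSpace Ω] (μ : Measure Ω) [IsProbabilityMeasure μ]
    (X : ℕ → Fin K → Fin K → Ω → Bool) (hX : IsDuelFeedback P μ X)
    (I : Ω → Fin K) (Q : Ω → Fin (K - 1) → Fin K) (hIQ : IsUniformStart μ I Q)
    (hindep : IndepFun (fun ω => (I ω, Q ω)) (fun ω t i j => X t i j ω) μ)
    (T : ℕ) :
    let R : Ω → ℝ := fun ω =>
      (BtWR.cumBinaryWeakRegret P a (BtWR.roundLength (minGap P a) (1 / Real.exp 1))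
        (I ω) (Q ω) (fun t i j => X t i j ω) T : ℝ)
    Integrable R μ ∧
      ∫ ω, R ω ∂μ ≤ 20 * (K : ℝ) * Real.log K / minGap P a ^ 2 := by
  intro R
  set ℓ := BtWR.roundLength (minGap P a) (1 / Real.exp 1) with hℓ
  -- The regret as a function of the start and the first `T` feedback arrays, both with finitely
  -- many values; independence then allows the start to be frozen.
  let F : Fin K × (Fin (K - 1) → Fin K) → (Finset.range T → Fin K → Fin K → Bool) → ℝ :=
    fun p y => (BtWR.cumBinaryWeakRegret P a ℓ p.1 p.2 (BtWR.extendFeedback y) T : ℝ)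
  have hF : ∀ p ω, F p (fun s i j => X s i j ω)
      = (BtWR.cumBinaryWeakRegret P a ℓ p.1 p.2 (fun t i j => X t i j ω) T : ℝ) := fun p ω =>
    congrArg (Int.cast : ℤ → ℝ)
      (BtWR.cumBinaryWeakRegret_extendFeedback P a ℓ p.1 p.2 (fun t i j => X t i j ω) T)
  have hR : R = fun ω => F (I ω, Q ω) (fun s i j => X s i j ω) := funext fun ω =>
    (hF (I ω, Q ω) ω).symm
  have hmIQ : Measurable fun ω => (I ω, Q ω) :=
    hIQ.measurable_incumbent.prodMk hIQ.measurable_queue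
  have hmX := BtWR.measurable_history hX T
  have hind : IndepFun (fun ω => (I ω, Q ω)) (fun ω (s : Finset.range T) i j => X s i j ω) μ :=
    hindep.comp measurable_id
      (measurable_pi_lambda _ fun s : Finset.range T => measurable_pi_apply (s : ℕ))
  refine ⟨?_, ?_⟩
  · rw [hR]
    exact integrable_comp_of_finite (hmIQ.prodMk hmX) fun p => F p.1 p.2
  · rw [hR, integral_indepFun_of_finite hmIQ hmX hind F]
    have hbound : ∀ᵐ ω ∂μ, ∫ ω', F (I ω, Q ω) (fun s i j => X s i j ω') ∂μ
        ≤ 20 * (K : ℝ) * Real.log K / minGap P a ^ 2 := by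
      filter_upwards [hIQ.ae_injective hK] with ω hω
      simp only [hF]
      exact BtWR.integral_cumBinaryWeakRegret_le hK hP ha hX hω.1 hω.2 T
    refine (integral_mono_ae (integrable_comp_of_finite hmIQ fun p =>
      ∫ ω', F p (fun s i j => X s i j ω') ∂μ) (integrable_const _) hbound).trans ?_
    simp
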